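/- Let $(X,d)$ be a metric space, $\mu\colon X^3\to X$ a ternary operation and $n\ge 0$ an integer. Write $x\sim_s y$ for $d(x,y)\le s$ and $[x,z]=\{\mu(x,y,z):y\in X\}$. *Definitions.* A median algebra is a set with a ternary operation $m$ such that $m(a,a,b)=a$, $m$ is invariant under all permutations of its three arguments, and $m(m(a,b,c),b,d)=m(a,b,m(c,b,d))$. The median cube $I^k$ is $(\mathbb Z/2)^k$ with coordinatewise majority vote, and the rank of a median algebra is the supremum of those $k$ for which it has a subalgebra isomorphic to $I^k$. The triple $(X,d,\mu)$ is a coarse median space if (M1) and (M2) below hold together with: - (C1) there are constants $K,H_0\ge 0$ with $d(\mu(a,b,c),\mu(a',b',c'))\le K\,(d(a,a')+d(b,b')+d(c,c'))+H_0$ for all $a,b,c,a',b',c'\in X$; - (C2) there is a function $H\colon\mathbb N\to[0,\infty)$ such that for every $p\in\mathbb N$ and every finite $A\subseteq X$ with $1\le|A|\le p$ there are a finite median algebra $(\Pi,\mu_\Pi)$ and maps $\pi\colon A\to\Pi$, $\lambda\colon\Pi\to X$ with $\lambda\mu_\Pi(x,y,z)\sim_{H(p)}\mu(\lambda x,\lambda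 y,\lambda z)$ for all $x,y,z\in\Pi$ and $\lambda\pi a\sim_{H(p)}a$ for all $a\in A$. It has rank at most $n$ if $K$, $H_0$ and $H$ exist such that (C1) holds and the algebras $\Pi$ in (C2) can always be chosen of rank at most $n$. **Theorem.** $(X,d,\mu)$ is a coarse median space of rank at most $n$ if and only if the following five conditions hold: - (M1) $\mu(a,a,b)=a$ for all $a,b\in X$; - (M2) $\mu(a_{\sigma(1)},a_{\sigma(2)},a_{\sigma(3)})=\mu(a_1,a_2,a_3)$ for all $a_1,a_2,a_3\in X$ and every permutation $\sigma$ of $\{1,2,3\}$; - (C1)$'$ there is an affine function $\rho\colon[0,\infty)\to[0,\infty)$ such that $d(\mu(a,b,c),\mu(a',b,c))\le\rho(d(a,a'))$ for all $a,a',b,c\in X$; - (C2)$'$ there is a constant $\kappa_4>0$ such that $\mu(\mu(a,b,c),b,d)\sim_{\kappa_4}\mu(a,b,\mu(c,b,d))$ for all $a,b,c,d\in X$; - (C3)$'$ for every $\lambda>0$ there is a constant $C=C(\lambda)$ such that for all $a,b\in X$ and all $e_1,\dots,e_{n+1}\in[a,b]$ with $\mu(e_i,a,e_j)\sim_\lambda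 a$ for all $i\ne j$, there is an $i$ with $e_i\sim_C a$. -/

import Mathlib

open scoped NNReal

namespace CoarseMedian

/-- (M1), localisation: `m(a,a,b) = a`. -/
def Localisation {X : Type*} (m : X → X → X → X) : Prop :=
  ∀ a b, m a a b = a

/-- (M2), symmetry: `m` is invariant under all permutations of its three arguments. -/
def Symmetry {X : Type*} (m : X → X → X → X) : Prop :=
  ∀ (a : Fin 3 → X) (σ : Equiv.Perm (Fin 3)),
    m (a (σ 0)) (a (σ 1)) (a (σ 2)) = m (a 0) (a 1) (a 2)

/-- `(X, m)` is a median algebra: (M1), (M2) and the 4-point condition (M3). -/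
structure IsMedianAlgebra {X : Type*} (m : X → X → X → X) : Prop where
  localisation : Localisation m
  symmetry : Symmetry m
  four_point : ∀ a b c d, m (m a b c) b d = m a b (m c b d)

/-- The underlying set of the median `k`-cube `I^k`. -/
abbrev Cube (k : ℕ) : Type := Fin k → ZMod 2

/-- The median of `I^k`: coordinatewise majority vote. -/
def cubeMedian (k : ℕ) (x y z : Cube k) : Cube k :=
  fun i => if x i = y i then x i else z i

/-- `(X, m)` has a subalgebra isomorphic to the median cube `I^k`. -/
def HasCube {X : Type*} (m : X → X → X → X) (k : ℕ) : Prop :=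
  ∃ S : Set X, (∀ x ∈ S, ∀ y ∈ S, ∀ z ∈ S, m x y z ∈ S) ∧
    ∃ e : Cube k ≃ S, ∀ x y z, (e (cubeMedian k x y z) : X) = m (e x) (e y) (e z)

/-- The rank of a median algebra: the supremum of those `k` for which it has a subalgebra
isomorphic to `I^k`. -/
noncomputable def medianRank {X : Type*} (m : X → X → X → X) : ℕ∞ :=
  ⨆ (k : ℕ) (_ : HasCube m k), (k : ℕ∞)

/-- The data asked for by (C2) for one finite set `A`, with error `r`: a finite median algebra
with a map `proj` from `A` to it and a map `emb` from it to `X`. Every finite algebra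
has a copy in `Type`, so the universe is no restriction. -/
structure Approximation {X : Type*} [MetricSpace X] (μ : X → X → X → X) (A : Finset X)
    (r : ℝ) where
  carrier : Type
  finite : Finite carrier
  med : carrier → carrier → carrier → carrier
  isMedianAlgebra : IsMedianAlgebra med
  proj : A → carrier
  emb : carrier → X
  quasi_morphism : ∀ x y z, dist (emb (med x y z)) (μ (emb x) (emb y) (emb z)) ≤ r
  close : ∀ a : A, dist (emb (proj a)) a ≤ r

/-- (C1) with the affine control function `t ↦ K t + H₀`. -/
def ControlledBy {X : Type*} [MetricSpace X] (μ : X → X → X → X) (K H₀ : ℝ≥0) : Prop :=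
  ∀ a b c a' b' c',
    dist (μ a b c) (μ a' b' c') ≤ K * (dist a a' + dist b b' + dist c c') + H₀

/-- (C2) with the parameter function `H`. -/
def ApproximableBy {X : Type*} [MetricSpace X] (μ : X → X → X → X) (H : ℕ → ℝ≥0) : Prop :=
  ∀ (p : ℕ) (A : Finset X), 1 ≤ A.card → A.card ≤ p → Nonempty (Approximation μ A (H p))

/-- (C2) with the parameter function `H`, where moreover the approximating median algebras can
always be chosen of rank at most `n`. -/
def ApproximableInRankBy {X : Type*} [MetricSpace X] (μ : X → X → X → X) (n : ℕ)
    (H : ℕ → ℝ≥0) : Prop :=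
  ∀ (p : ℕ) (A : Finset X), 1 ≤ A.card → A.card ≤ p →
    ∃ P : Approximation μ A (H p), medianRank P.med ≤ n

/-- `(X, d, μ)` is a coarse median space: (M1), (M2), (C1) and (C2). -/
structure IsCoarseMedianSpace {X : Type*} [MetricSpace X] (μ : X → X → X → X) : Prop where
  localisation : Localisation μ
  symmetry : Symmetry μ
  controlled : ∃ K H₀ : ℝ≥0, ControlledBy μ K H₀
  approximable : ∃ H : ℕ → ℝ≥0, ApproximableBy μ H

/-- Rank at most `n`: there are parameters for which the approximating median algebras can always
be chosen of rank at most `n`. -/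
def HasRankAtMost {X : Type*} [MetricSpace X] (μ : X → X → X → X) (n : ℕ) : Prop :=
  ∃ (K H₀ : ℝ≥0) (H : ℕ → ℝ≥0), ControlledBy μ K H₀ ∧ ApproximableInRankBy μ n H

/-- The interval `[x,z] = {μ(x,y,z) : y ∈ X}`. -/
def interval {X : Type*} (μ : X → X → X → X) (x z : X) : Set X :=
  {w | ∃ y, w = μ x y z}

/-- (C1)': affine control in the first variable. -/
def AffineControl {X : Type*} [MetricSpace X] (μ : X → X → X → X) : Prop :=
  ∃ K H₀ : ℝ≥0, ∀ a a' b c, dist (μ a b c) (μ a' b c) ≤ K * dist a a' + H₀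

/-- (C2)': the coarse 4-point condition. -/
def CoarseFourPoint {X : Type*} [MetricSpace X] (μ : X → X → X → X) : Prop :=
  ∃ κ : ℝ, 0 < κ ∧ ∀ a b c d, dist (μ (μ a b c) b d) (μ a b (μ c b d)) ≤ κ

/-- (C3)': no arbitrarily large corners of coarse `(n+1)`-cubes. -/
def NoLargeCorners {X : Type*} [MetricSpace X] (μ : X → X → X → X) (n : ℕ) : Prop :=
  ∀ r : ℝ, 0 < r → ∃ C : ℝ, ∀ (a b : X) (e : Fin (n + 1) → X),
    (∀ i, e i ∈ interval μ a b) →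
    (∀ i j, i ≠ j → dist (μ (e i) a (e j)) a ≤ r) →
    ∃ i, dist (e i) a ≤ C

end CoarseMedian

namespace CoarseMedian

theorem Symmetry.swap_left {X : Type*} {m : X → X → X → X} (h : Symmetry m) (a b c : X) :
    m b a c = m a b c := by
  have := h ![a, b, c] (Equiv.swap 0 1)
  simpa [Equiv.swap_apply_of_ne_of_ne] using this

theorem Symmetry.swap_right {X : Type*} {m : X → X → X → X} (h : Symmetry m) (a b c : X) :
    m a c b = m a b c := by
  have := h ![a, b, c] (Equiv.swap 1 2)
  simpa [Equiv.swap_apply_of_ne_of_ne] using this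

theorem Symmetry.rotate {X : Type*} {m : X → X → X → X} (h : Symmetry m) (a b c : X) :
    m b c a = m a b c := by
  rw [h.swap_right b a c, h.swap_left]

theorem symmetry_of_swap {X : Type*} {m : X → X → X → X} (h₁ : ∀ a b c, m b a c = m a b c)
    (h₂ : ∀ a b c, m a c b = m a b c) : Symmetry m := by
  intro a σ
  have key : ∀ σ : Equiv.Perm (Fin 3),
      (σ 0 = 0 ∧ σ 1 = 1 ∧ σ 2 = 2) ∨ (σ 0 = 0 ∧ σ 1 = 2 ∧ σ 2 = 1) ∨
      (σ 0 = 1 ∧ σ 1 = 0 ∧ σ 2 = 2) ∨ (σ 0 = 1 ∧ σ 1 = 2 ∧ σ 2 = 0) ∨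
      (σ 0 = 2 ∧ σ 1 = 0 ∧ σ 2 = 1) ∨ (σ 0 = 2 ∧ σ 1 = 1 ∧ σ 2 = 0) := by decide
  rcases key σ with ⟨h0, h1, h2⟩ | ⟨h0, h1, h2⟩ | ⟨h0, h1, h2⟩ | ⟨h0, h1, h2⟩ | ⟨h0, h1, h2⟩ |
    ⟨h0, h1, h2⟩ <;> rw [h0, h1, h2]
  · rw [h₂]
  · rw [h₁]
  · rw [h₂ (a 1) (a 0), h₁]
  · rw [h₁, h₂]
  · rw [h₁, h₂, h₁]

/-! ### Betweenness, gates and separation in median algebras -/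

/-- `x` lies between `a` and `b`. -/
def Btw {M : Type*} (m : M → M → M → M) (a x b : M) : Prop := m x a b = x

/-- `h` is a homomorphism to the two-element median algebra. -/
def IsBoolHom {M : Type*} (m : M → M → M → M) (h : M → Bool) : Prop :=
  ∀ x y z, h (m x y z) = (h x && h y || h y && h z || h x && h z)

/-- `C` is a convex subset. -/
def IsConvex {M : Type*} (m : M → M → M → M) (C : Set M) : Prop :=
  ∀ a ∈ C, ∀ b ∈ C, ∀ x, Btw m a x b → x ∈ C

namespace IsMedianAlgebra

variable {M : Type*} {m : M → M → M → M}

theorem aba (hm : IsMedianAlgebra m) (a b : M) : m a b a = a := by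
  rw [hm.symmetry.swap_right]; exact hm.localisation a b

theorem baa (hm : IsMedianAlgebra m) (a b : M) : m b a a = a := by
  rw [hm.symmetry.swap_left]; exact hm.aba a b

theorem btw_symm (hm : IsMedianAlgebra m) {a x b : M} (h : Btw m a x b) : Btw m b x a := by
  unfold Btw at *
  rw [hm.symmetry.swap_right]; exact h

theorem btw_left (hm : IsMedianAlgebra m) (a b : M) : Btw m a a b := hm.localisation a b

theorem eq_of_btw_self (hm : IsMedianAlgebra m) {a x : M} (h : Btw m a x a) : x = a := by
  rw [← show m x a a = x from h, hm.baa]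

theorem btw_trans (hm : IsMedianAlgebra m) {b x y z : M} (h₁ : Btw m b x y) (h₂ : Btw m b y z) :
    Btw m b x z := by
  unfold Btw at *
  have := hm.four_point x b y z
  rwa [h₁, h₂, h₁] at this

theorem btw_middle (hm : IsMedianAlgebra m) {b x y z : M} (h₁ : Btw m b x y)
    (h₂ : Btw m b y z) : Btw m x y z := by
  have := hm.four_point x y b z
  have e : m x y b = x := by rw [hm.symmetry.swap_right]; exact h₁
  have e' : m b y z = y := by rw [hm.symmetry.swap_left]; exact h₂
  rw [e, e', hm.baa] at this
  unfold Btw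
  rwa [hm.symmetry.swap_left]

/-- In the order by betweenness from `b`, the element `m x b y` is the meet of `x` and `y`. -/
theorem btw_inf (hm : IsMedianAlgebra m) {b w x y : M} (h₁ : Btw m b w x) (h₂ : Btw m b w y) :
    Btw m b w (m x b y) := by
  unfold Btw at *
  rw [← hm.four_point, h₁, h₂]

theorem eq_base (hm : IsMedianAlgebra m) {b w x y : M} (h₁ : Btw m b w x) (h₂ : Btw m b w y)
    (h : Btw m x b y) : w = b := by
  have e := hm.btw_inf h₁ h₂
  rw [hm.symmetry.swap_left, show m b x y = b from h] at e
  exact hm.eq_of_btw_self e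

theorem btw_med₁₂ (hm : IsMedianAlgebra m) (x y z : M) : Btw m x (m x y z) y := by
  have h := hm.four_point z y x x
  rw [hm.aba, hm.symmetry.rotate x z y, hm.symmetry.swap_right x y z,
    hm.symmetry.swap_right _ x y] at h
  exact h

theorem btw_med₁₃ (hm : IsMedianAlgebra m) (x y z : M) : Btw m x (m x y z) z := by
  rw [← hm.symmetry.swap_right]; exact hm.btw_med₁₂ x z y

theorem btw_med₂₃ (hm : IsMedianAlgebra m) (x y z : M) : Btw m y (m x y z) z := by
  rw [← hm.symmetry.rotate]; exact hm.btw_med₁₂ y z x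

theorem btw_antisymm (hm : IsMedianAlgebra m) {w x y : M} (h₁ : Btw m w x y)
    (h₂ : Btw m x w y) : x = w := by
  unfold Btw at *
  rw [← h₁, hm.symmetry.swap_left, h₂]

theorem eq_med (hm : IsMedianAlgebra m) {w x y z : M} (h₁ : Btw m x w y) (h₂ : Btw m y w z)
    (h₃ : Btw m x w z) : w = m x y z := by
  have a₁ : Btw m x w (m x y z) := by
    rw [← hm.symmetry.swap_left]; exact hm.btw_inf h₁ h₃
  have a₂ : Btw m y w (m x y z) := hm.btw_inf (hm.btw_symm h₁) h₂
  exact (hm.btw_antisymm (hm.btw_middle a₁ (hm.btw_med₁₂ x y z)) (hm.btw_symm a₂)).symm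

/-- `m x y z` is the gate of `z` in the interval `[x, y]`. -/
theorem gate (hm : IsMedianAlgebra m) {x y q : M} (z : M) (hq : Btw m x q y) :
    Btw m z (m x y z) q := by
  -- With `u = m q x z` and `v = m q y z`, the median `t` of `u`, `z`, `v` lies in all three
  -- intervals spanned by `x`, `y`, `z`, so it is `m x y z`. It also lies between `z` and `u`, hence
  -- between `z` and `q`.
  have uq : Btw m z (m q x z) q := hm.btw_symm (hm.btw_med₁₃ q x z)
  have ux : Btw m z (m q x z) x := hm.btw_symm (hm.btw_med₂₃ q x z)
  have xuq : Btw m x (m q x z) q := hm.btw_symm (hm.btw_med₁₂ q x z)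
  have vq : Btw m z (m q y z) q := hm.btw_symm (hm.btw_med₁₃ q y z)
  have vy : Btw m z (m q y z) y := hm.btw_symm (hm.btw_med₂₃ q y z)
  have yvq : Btw m y (m q y z) q := hm.btw_symm (hm.btw_med₁₂ q y z)
  generalize m q x z = u at *
  generalize m q y z = v at *
  have yqx := hm.btw_symm hq
  have xqv : Btw m x q v := hm.btw_symm (hm.btw_middle yvq yqx)
  have xuv : Btw m x u v := hm.btw_trans xuq xqv
  have xvy : Btw m x v y := hm.btw_symm (hm.btw_trans yvq yqx)
  have vtu : Btw m v (m u z v) u := hm.btw_symm (hm.btw_med₁₃ u z v)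
  have ztu : Btw m z (m u z v) u := hm.btw_symm (hm.btw_med₁₂ u z v)
  have ztv : Btw m z (m u z v) v := hm.btw_med₂₃ u z v
  generalize m u z v = t at *
  have xty : Btw m x t y :=
    hm.btw_trans (hm.btw_symm (hm.btw_trans vtu (hm.btw_symm xuv))) xvy
  have ztx := hm.btw_trans ztu ux
  have zty := hm.btw_trans ztv vy
  rw [← hm.eq_med xty (hm.btw_symm zty) (hm.btw_symm ztx)]
  exact hm.btw_trans ztu uq

theorem interval_convex (hm : IsMedianAlgebra m) {x y p q z : M} (hp : Btw m x p y)
    (hq : Btw m x q y) (hz : Btw m p z q) : Btw m x z y := by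
  rw [← hm.eq_base (hm.gate z hp) (hm.gate z hq) hz]
  exact hm.btw_med₁₂ x y z

/-- The median `c` of the three gates lies between `w'` and both `a` and `b`, hence between `w'` and
the gate of `w'` in `[a, b]`, hence between `w'` and `w`. As `w'` is the gate of `w` and `c` is in
`[x, y]`, this forces `c = w'`. -/
theorem retract_btw (hm : IsMedianAlgebra m) (x y : M) {a w b : M} (h : Btw m a w b) :
    Btw m (m x y a) (m x y w) (m x y b) := by
  have xay := hm.btw_med₁₂ x y a
  have xby := hm.btw_med₁₂ x y b
  have xwy := hm.btw_med₁₂ x y w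
  have wa : Btw m (m x y w) (m x y a) a := hm.btw_symm (hm.gate a xwy)
  have wb : Btw m (m x y w) (m x y b) b := hm.btw_symm (hm.gate b xwy)
  have hw : ∀ q, Btw m x q y → Btw m w (m x y w) q := fun q hq => hm.gate w hq
  generalize m x y a = a' at *
  generalize m x y b = b' at *
  generalize m x y w = w' at *
  have wha : Btw m w' (m a' w' b') a := hm.btw_trans (hm.btw_symm (hm.btw_med₁₂ _ _ _)) wa
  have whb : Btw m w' (m a' w' b') b := hm.btw_trans (hm.btw_med₂₃ _ _ _) wb
  have ahb : Btw m a' (m a' w' b') b' := hm.btw_med₁₃ _ _ _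
  generalize m a' w' b' = c at *
  have whg := hm.btw_inf wha whb
  have wgw : Btw m w' (m a w' b) w := by
    rw [hm.symmetry.swap_right]; exact hm.gate w' h
  have whw := hm.btw_trans whg wgw
  have wwh := hw c (hm.interval_convex xay xby ahb)
  rwa [hm.btw_antisymm whw (hm.btw_symm wwh)] at ahb

theorem retract_med (hm : IsMedianAlgebra m) (x y a b c : M) :
    m x y (m a b c) = m (m x y a) (m x y b) (m x y c) :=
  hm.eq_med (hm.retract_btw x y (hm.btw_med₁₂ a b c)) (hm.retract_btw x y (hm.btw_med₂₃ a b c))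
    (hm.retract_btw x y (hm.btw_med₁₃ a b c))

/-- The union of the intervals from a point to a convex set is convex. -/
theorem convex_join (hm : IsMedianAlgebra m) {C : Set M} (hC : IsConvex m C) (u : M) :
    IsConvex m {t | ∃ c ∈ C, Btw m c t u} := by
  rintro p ⟨c₁, hc₁, hp⟩ q ⟨c₂, hc₂, hq⟩ t ht
  refine ⟨m c₁ c₂ t, hC _ hc₁ _ hc₂ _ (hm.btw_med₁₂ _ _ _), ?_⟩
  -- Projecting to `[u, t]` puts the image of `c` between `t` and the image of `p`. The meet, seen
  -- from `t`, of the images of `c₁` and `c₂` is then below the images of `p` and `q`, between which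
  -- `t` lies, so it equals `t`.
  have key : ∀ {c p : M}, Btw m c p u → Btw m t (m u t c) (m u t p) := by
    intro c p h
    have h₁ := hm.retract_btw u t h
    rw [hm.aba] at h₁
    exact hm.btw_symm (hm.btw_middle (hm.btw_symm h₁) (hm.btw_med₁₂ u t c))
  have h₁ := hm.btw_trans (hm.btw_symm (hm.btw_med₁₂ (m u t c₁) t (m u t c₂))) (key hp)
  have h₂ := hm.btw_trans (hm.btw_med₂₃ (m u t c₁) t (m u t c₂)) (key hq)
  have ht' := hm.retract_btw u t ht
  rw [hm.baa] at ht'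
  have h₄ := hm.eq_base h₁ h₂ ht'
  have h₅ : m u t (m c₁ c₂ t) = t := by
    rw [hm.retract_med, hm.baa, hm.symmetry.swap_right]; exact h₄
  rw [hm.symmetry.swap_left] at h₅
  exact hm.btw_symm h₅

/-- Homomorphisms to the two-element median algebra separate points. -/
theorem exists_boolHom (hm : IsMedianAlgebra m) {x y : M} (hxy : x ≠ y) :
    ∃ h : M → Bool, IsBoolHom m h ∧ h x ≠ h y := by
  obtain ⟨C, hxC, hC⟩ := zorn_subset_nonempty {C : Set M | IsConvex m C ∧ y ∉ C} (by
    intro c hc hchain hne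
    refine ⟨⋃₀ c, ⟨?_, ?_⟩, fun s hs => Set.subset_sUnion_of_mem hs⟩
    · rintro a ⟨s, hs, ha⟩ b ⟨t, ht, hb⟩ z hz
      rcases hchain.total hs ht with hst | hst
      · exact ⟨t, ht, (hc ht).1 a (hst ha) b hb z hz⟩
      · exact ⟨s, hs, (hc hs).1 a ha b (hst hb) z hz⟩
    · rintro ⟨s, hs, hy⟩
      exact (hc hs).2 hy) {x} (by
    refine ⟨?_, fun h => hxy h.symm⟩
    rintro a rfl b rfl z hz
    exact hm.eq_of_btw_self hz)
  obtain ⟨hconv, hyC⟩ := hC.prop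
  have hxC : x ∈ C := hxC rfl
  -- By maximality of `C`, its convex join with an outside point must contain `y`.
  have join : ∀ u ∉ C, ∃ c ∈ C, Btw m c y u := by
    intro u hu
    by_contra hcon
    have hsub : C ⊆ {t | ∃ c ∈ C, Btw m c t u} := fun c hc => ⟨c, hc, hm.btw_left c u⟩
    have := hC.le_of_ge ⟨hm.convex_join hconv u, hcon⟩ hsub
    exact hu (this ⟨x, hxC, hm.btw_symm (hm.btw_left u x)⟩)
  -- If `w ∈ C` lay between `u` and `v`, pick `s ∈ C` between `y` and each of `c₁`, `c₂`, `w`.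
  -- Projection to `[y, s]` sends `u` and `v` to `y` but `w` to `s`, so `s = y`, contradicting `y ∉
  -- C`.
  have hcompl : IsConvex m Cᶜ := by
    intro u hu v hv w hw hwC
    obtain ⟨c₁, hc₁, h₁⟩ := join u hu
    obtain ⟨c₂, hc₂, h₂⟩ := join v hv
    have hd : m c₂ y w ∈ C := hconv _ hc₂ _ hwC _ (hm.btw_med₁₃ _ _ _)
    have hs : m c₁ y (m c₂ y w) ∈ C := hconv _ hc₁ _ hd _ (hm.btw_med₁₃ _ _ _)
    have s₁ : Btw m y (m c₁ y (m c₂ y w)) c₁ := hm.btw_symm (hm.btw_med₁₂ _ _ _)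
    have sd : Btw m y (m c₁ y (m c₂ y w)) (m c₂ y w) := hm.btw_med₂₃ _ _ _
    have s₂ := hm.btw_trans sd (hm.btw_symm (hm.btw_med₁₂ _ _ _))
    have sw := hm.btw_trans sd (hm.btw_med₂₃ c₂ y w)
    generalize m c₁ y (m c₂ y w) = s at *
    have key : ∀ {c u : M}, Btw m y s c → Btw m c y u → m y s u = y := by
      intro c u hc hu
      have a₁ : Btw m y (m y s u) c := hm.btw_trans (hm.btw_med₁₂ y s u) hc
      have a₂ : Btw m y (m y s u) u := hm.btw_med₁₃ y s u
      exact hm.eq_base a₁ a₂ hu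
    have := hm.retract_btw y s hw
    rw [key s₁ h₁, key s₂ h₂] at this
    have e := hm.eq_of_btw_self this
    have e' : m y s w = s := by rw [hm.symmetry.swap_left]; exact sw
    rw [e'] at e
    exact hyC (e ▸ hs)
  classical
  refine ⟨fun z => decide (z ∈ C), ?_, by simp [hxC, hyC]⟩
  intro a b c
  by_cases ha : a ∈ C <;> by_cases hb : b ∈ C <;> by_cases hc : c ∈ C <;> simp [ha, hb, hc]
  · exact hconv _ ha _ hb _ (hm.btw_med₁₂ a b c)
  · exact hconv _ ha _ hb _ (hm.btw_med₁₂ a b c)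
  · exact hconv _ ha _ hc _ (hm.btw_med₁₃ a b c)
  · exact hcompl _ hb _ hc _ (hm.btw_med₂₃ a b c)
  · exact hconv _ hb _ hc _ (hm.btw_med₂₃ a b c)
  · exact hcompl _ ha _ hc _ (hm.btw_med₁₃ a b c)
  · exact hcompl _ ha _ hb _ (hm.btw_med₁₂ a b c)
  · exact hcompl _ ha _ hb _ (hm.btw_med₁₂ a b c)

theorem eq_of_boolHom (hm : IsMedianAlgebra m) {x y : M}
    (h : ∀ f : M → Bool, IsBoolHom m f → f x = f y) : x = y := by
  by_contra hxy
  obtain ⟨f, hf, hne⟩ := hm.exists_boolHom hxy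
  exact hne (h f hf)

end IsMedianAlgebra
-- Finite generation, corners and rank
/-- The subalgebra generated by a family `g`. -/
inductive Generated {M ι : Type*} (m : M → M → M → M) (g : ι → M) : M → Prop
  | base (j : ι) : Generated m g (g j)
  | med {x y z : M} : Generated m g x → Generated m g y → Generated m g z →
      Generated m g (m x y z)

theorem Generated.boolHom_eq {M ι : Type*} {m : M → M → M → M} {g : ι → M} {x : M}
    (hx : Generated m g x) {h h' : M → Bool} (hh : IsBoolHom m h) (hh' : IsBoolHom m h')
    (e : ∀ j, h (g j) = h' (g j)) : h x = h' x := by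
  induction hx with
  | base j => exact e j
  | med _ _ _ hx hy hz => rw [hh, hh', hx, hy, hz]

theorem isMedianAlgebra_of_injective {M N : Type*} {m : M → M → M → M} (hm : IsMedianAlgebra m)
    {med : N → N → N → N} {f : N → M} (hf : Function.Injective f)
    (hmed : ∀ x y z, f (med x y z) = m (f x) (f y) (f z)) : IsMedianAlgebra med where
  localisation a b := hf (by rw [hmed, hm.localisation])
  symmetry := symmetry_of_swap
    (fun a b c => hf (by rw [hmed, hmed, hm.symmetry.swap_left]))
    (fun a b c => hf (by rw [hmed, hmed, hm.symmetry.swap_right]))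
  four_point a b c d := hf (by simp only [hmed, hm.four_point])

/-- An exact corner: the `e i` lie in `[a, b]` and are pairwise disjoint as seen from `a`. -/
structure IsCorner {M ι : Type*} (m : M → M → M → M) (a b : M) (e : ι → M) : Prop where
  btw : ∀ i, m a (e i) b = e i
  disjoint : ∀ i j, i ≠ j → m (e i) a (e j) = a

theorem exists_corner_of_hasCube {M : Type*} {m : M → M → M → M} {n k : ℕ} (hk : n ≤ k)
    (h : HasCube m k) :
    ∃ (a b : M) (e : Fin n → M), IsCorner m a b e ∧ ∀ i, e i ≠ a := by
  obtain ⟨S, -, φ, hφ⟩ := h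
  refine ⟨φ 0, φ 1, fun i => φ (Pi.single (Fin.castLE hk i) 1), ⟨?_, ?_⟩, ?_⟩
  · intro i
    rw [← hφ]
    congr 2
    funext l
    by_cases hl : l = Fin.castLE hk i
    · subst hl; simp [cubeMedian]
    · simp [cubeMedian, hl]
  · intro i j hij
    rw [← hφ]
    congr 2
    funext l
    by_cases hl : l = Fin.castLE hk i
    · subst hl
      have : Fin.castLE hk i ≠ Fin.castLE hk j := fun h => hij (Fin.castLE_injective hk h)
      simp [cubeMedian, this]
    · simp [cubeMedian, hl]
  · intro i hi
    have := congrFun (φ.injective (Subtype.ext hi)) (Fin.castLE hk i)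
    simp at this

/-- The join, in the interval `[a, b]` seen from `a`, of a list of points. -/
def joinList {M : Type*} (m : M → M → M → M) (a b : M) : List M → M
  | [] => a
  | x :: l => m x b (joinList m a b l)

theorem IsBoolHom.apply_btw {M : Type*} {m : M → M → M → M} {h : M → Bool} (hh : IsBoolHom m h)
    {a x b : M} (hx : m a x b = x) : h x = (h a && h x || h x && h b || h a && h b) := by
  have := hh a x b
  rwa [hx] at this

/-- If `h a = h b`, the whole interval has the value `h a`; otherwise `m x b y` acts as disjunction
of "differs from `h a`". -/
theorem IsBoolHom.joinList_ne {M : Type*} {m : M → M → M → M} {h : M → Bool}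
    (hh : IsBoolHom m h) {a b : M} {l : List M} (hl : ∀ x ∈ l, m a x b = x) :
    h (joinList m a b l) ≠ h a ↔ ∃ x ∈ l, h x ≠ h a := by
  induction l with
  | nil => simp [joinList]
  | cons x l ih =>
    have ih := ih fun y hy => hl y (List.mem_cons_of_mem _ hy)
    have hx := hh.apply_btw (hl x List.mem_cons_self)
    have hab : h a = h b → h (joinList m a b l) = h a := by
      intro hab
      by_contra hne
      obtain ⟨y, hy, hya⟩ := ih.1 hne
      have := hh.apply_btw (hl y (List.mem_cons_of_mem _ hy))
      rw [hab] at this hya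
      revert this hya
      cases h y <;> cases h b <;> simp
    rw [show (∃ y ∈ x :: l, h y ≠ h a) ↔ h x ≠ h a ∨ ∃ y ∈ l, h y ≠ h a by simp, ← ih, joinList, hh]
    revert hx hab
    cases h x <;> cases h a <;> cases h b <;> cases h (joinList m a b l) <;> simp

namespace IsMedianAlgebra

variable {M : Type*} {m : M → M → M → M}

/-- A generated element is determined by which value patterns on the generators make it true, and
there are finitely many sets of patterns. -/
theorem finite_generated (hm : IsMedianAlgebra m) {ι : Type*} [Finite ι] (g : ι → M) :
    Finite {x // Generated m g x} := by
  let Φ : {x // Generated m g x} → Set (ι → Bool) :=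
    fun x => {v | ∃ h, IsBoolHom m h ∧ (fun j => h (g j)) = v ∧ h x = true}
  have key : ∀ x y, Φ x = Φ y → ∀ h, IsBoolHom m h → h x.1 = true → h y.1 = true := by
    intro x y hxy h hh hx
    have : (fun j => h (g j)) ∈ Φ y := hxy ▸ ⟨h, hh, rfl, hx⟩
    obtain ⟨h', hh', e, hy⟩ := this
    rw [← hy]
    exact y.2.boolHom_eq hh hh' fun j => (congrFun e j).symm
  refine Finite.of_injective Φ fun x y hxy => Subtype.ext (hm.eq_of_boolHom fun h hh => ?_)
  exact Bool.eq_iff_iff.2 ⟨key x y hxy h hh, key y x hxy.symm h hh⟩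

/-- Finitely generated median algebras are finite. -/
theorem exists_finite_subalgebra (hm : IsMedianAlgebra m) {ι : Type*} [Finite ι] (g : ι → M) :
    ∃ (N : ℕ) (f : Fin N → M) (med : Fin N → Fin N → Fin N → Fin N), Function.Injective f ∧
      (∀ x y z, f (med x y z) = m (f x) (f y) (f z)) ∧ ∀ j, g j ∈ Set.range f := by
  have := hm.finite_generated g
  obtain ⟨N, ⟨φ⟩⟩ := Finite.exists_equiv_fin {x // Generated m g x}
  refine ⟨N, fun i => φ.symm i, fun x y z => φ ⟨_, (φ.symm x).2.med (φ.symm y).2 (φ.symm z).2⟩,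
    Subtype.val_injective.comp φ.symm.injective, fun x y z => by simp, fun j => ?_⟩
  exact ⟨φ ⟨g j, .base j⟩, by simp⟩

/-- Send a vertex to the join of the edges in its support. By disjointness a two-valued homomorphism
separates at most one edge from `a`, so on the cube it is constant or reads off one coordinate up to
negation. Nondegenerate edges give injectivity. -/
theorem hasCube_of_corner (hm : IsMedianAlgebra m) {n : ℕ} {a b : M} {e : Fin n → M}
    (he : IsCorner m a b e) (hne : ∀ i, e i ≠ a) : HasCube m n := by
  let φ : Cube n → M := fun s =>
    joinList m a b ((Finset.univ.filter fun i => s i = 1).toList.map e)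
  have spec : ∀ h, IsBoolHom m h → ∀ s, h (φ s) ≠ h a ↔ ∃ i, s i = 1 ∧ h (e i) ≠ h a := by
    intro h hh s
    have := hh.joinList_ne (a := a) (b := b)
      (l := (Finset.univ.filter fun i => s i = 1).toList.map e) (by
        intro x hx
        obtain ⟨i, -, rfl⟩ := List.mem_map.1 hx
        exact he.btw i)
    refine this.trans ⟨?_, ?_⟩
    · rintro ⟨x, hx, hxa⟩
      obtain ⟨i, hi, rfl⟩ := List.mem_map.1 hx
      exact ⟨i, by simpa using hi, hxa⟩
    · rintro ⟨i, hi, hia⟩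
      exact ⟨e i, List.mem_map.2 ⟨i, by simpa using hi, rfl⟩, hia⟩
  have spec' : ∀ h, IsBoolHom m h → ∀ i, h (e i) ≠ h a → ∀ s, h (φ s) ≠ h a ↔ s i = 1 := by
    intro h hh i hi s
    rw [spec h hh]
    refine ⟨?_, fun hs => ⟨i, hs, hi⟩⟩
    rintro ⟨j, hj, hja⟩
    by_cases hij : i = j
    · exact hij ▸ hj
    · have := hh (e i) a (e j)
      rw [he.disjoint i j hij] at this
      revert this hi hja
      cases h (e i) <;> cases h a <;> cases h (e j) <;> simp
  have hmed : ∀ s t u, φ (cubeMedian n s t u) = m (φ s) (φ t) (φ u) := by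
    intro s t u
    refine hm.eq_of_boolHom fun h hh => ?_
    rw [hh]
    by_cases hex : ∃ i, h (e i) ≠ h a
    · obtain ⟨i, hi⟩ := hex
      have h₁ := spec' h hh i hi s
      have h₂ := spec' h hh i hi t
      have h₃ := spec' h hh i hi u
      have h₄ := spec' h hh i hi (cubeMedian n s t u)
      have two : ∀ x : ZMod 2, x = 0 ∨ x = 1 := by decide
      unfold cubeMedian at h₄ ⊢
      generalize h (φ fun i => if s i = t i then s i else u i) = w at *
      rcases two (s i) with hs | hs <;> rcases two (t i) with ht | ht <;>
        rcases two (u i) with hu | hu <;> simp only [hs, ht, hu] at h₁ h₂ h₃ h₄ <;>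
        revert h₁ h₂ h₃ h₄ <;> cases h (φ s) <;> cases h (φ t) <;> cases h (φ u) <;>
        cases h a <;> cases w <;> simp
    · have hall : ∀ s, h (φ s) = h a := by
        intro s
        by_contra hs
        obtain ⟨i, -, hi⟩ := (spec h hh s).1 hs
        exact hex ⟨i, hi⟩
      simp [hall]
  have hinj : Function.Injective φ := by
    intro s t hst
    funext i
    obtain ⟨h, hh, hi⟩ := hm.exists_boolHom (hne i)
    have := (spec' h hh i hi s).symm.trans (hst ▸ spec' h hh i hi t)
    have two : ∀ x y : ZMod 2, (x = 1 ↔ y = 1) → x = y := by decide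
    exact two _ _ this
  refine ⟨Set.range φ, ?_, Equiv.ofInjective φ hinj, hmed⟩
  rintro _ ⟨s, rfl⟩ _ ⟨t, rfl⟩ _ ⟨u, rfl⟩
  exact ⟨_, hmed s t u⟩

/-- The rank is at most `n` iff every corner with `n + 1` edges is degenerate. -/
theorem medianRank_le_iff (hm : IsMedianAlgebra m) {n : ℕ} :
    medianRank m ≤ n ↔
      ∀ (a b : M) (e : Fin (n + 1) → M), IsCorner m a b e → ∃ i, e i = a := by
  constructor
  · intro h a b e he
    by_contra! hne
    have h₁ : ((n + 1 : ℕ) : ℕ∞) ≤ medianRank m :=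
      le_iSup₂_of_le (n + 1) (hm.hasCube_of_corner he hne) le_rfl
    have := h₁.trans h
    norm_cast at this
    omega
  · intro h
    refine iSup₂_le fun k hk => ?_
    by_contra hlt
    have hlt : n + 1 ≤ k := by
      have := not_le.1 hlt
      norm_cast at this
    obtain ⟨a, b, e, he, hne⟩ := exists_corner_of_hasCube hlt hk
    obtain ⟨i, hi⟩ := h a b e he
    exact hne i hi

/-- Elements of an interval `[a, b]` become disjoint after joining them with the join of their
pairwise meets. -/
theorem exists_isCorner_join (hm : IsMedianAlgebra m) {ι : Type*} {a b : M} {e : ι → M}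
    (he : ∀ i, m a (e i) b = e i) {l : List M}
    (hl : ∀ x, x ∈ l ↔ ∃ i j, i ≠ j ∧ x = m (e i) a (e j)) :
    IsCorner m (joinList m a b l) b (fun i => m (e i) b (joinList m a b l)) ∧
      ∀ i, m (e i) b (joinList m a b l) = joinList m a b l →
        e i = m (e i) a (joinList m a b l) := by
  have hl' : ∀ x ∈ l, m a x b = x := by
    intro x hx
    obtain ⟨i, j, -, rfl⟩ := (hl x).1 hx
    refine hm.eq_of_boolHom fun h hh => ?_
    have h₁ := hh.apply_btw (he i)
    have h₂ := hh.apply_btw (he j)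
    simp only [hh _ _ _]
    revert h₁ h₂
    cases h (e i) <;> cases h (e j) <;> cases h a <;> cases h b <;> simp
  -- The join already accounts for every `h` separating two edges from `a`; hence, seen from it, the
  -- enlarged edges are disjoint.
  have spec : ∀ h, IsBoolHom m h → (h (joinList m a b l) ≠ h a ↔
      ∃ i j, i ≠ j ∧ h (e i) ≠ h a ∧ h (e j) ≠ h a) := by
    intro h hh
    rw [hh.joinList_ne hl']
    have : ∀ i j, h (m (e i) a (e j)) ≠ h a ↔ (h (e i) ≠ h a ∧ h (e j) ≠ h a) := by
      intro i j
      rw [hh]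
      cases h (e i) <;> cases h (e j) <;> cases h a <;> simp
    constructor
    · rintro ⟨x, hx, hxa⟩
      obtain ⟨i, j, hij, rfl⟩ := (hl x).1 hx
      exact ⟨i, j, hij, (this i j).1 hxa⟩
    · rintro ⟨i, j, hij, h'⟩
      exact ⟨_, (hl _).2 ⟨i, j, hij, rfl⟩, (this i j).2 h'⟩
  generalize joinList m a b l = c at *
  have hc : ∀ h, IsBoolHom m h → h a = h b → h c = h a := by
    intro h hh hab
    by_contra hca
    obtain ⟨i, j, -, hi, -⟩ := (spec h hh).1 hca
    have := hh.apply_btw (he i)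
    revert this hi hab
    cases h (e i) <;> cases h a <;> cases h b <;> simp
  refine ⟨⟨fun i => ?_, fun i j hij => ?_⟩, fun i hi => ?_⟩
  · refine hm.eq_of_boolHom fun h hh => ?_
    have h₁ := hh.apply_btw (he i)
    have h₂ := hc h hh
    simp only [hh _ _ _]
    revert h₁ h₂
    cases h (e i) <;> cases h c <;> cases h a <;> cases h b <;> simp
  · refine hm.eq_of_boolHom fun h hh => ?_
    have h₁ := hh.apply_btw (he i)
    have h₂ := hc h hh
    have h₃ := hh.apply_btw (he j)
    have h₄ : h (e i) ≠ h a → h (e j) ≠ h a → h c ≠ h a :=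
      fun hi hj => (spec h hh).2 ⟨i, j, hij, hi, hj⟩
    simp only [hh _ _ _]
    revert h₁ h₂ h₃ h₄
    cases h (e i) <;> cases h (e j) <;> cases h c <;> cases h a <;> cases h b <;> simp
  · refine hm.eq_of_boolHom fun h hh => ?_
    have h₁ := hh.apply_btw (he i)
    have h₂ := hc h hh
    have h₃ := congrArg h hi
    simp only [hh _ _ _] at h₃ ⊢
    revert h₁ h₂ h₃
    cases h (e i) <;> cases h c <;> cases h a <;> cases h b <;> simp

end IsMedianAlgebra
-- From approximations to the coarse axioms
section Coarse

variable {X : Type*} [MetricSpace X] {μ : X → X → X → X}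

theorem ControlledBy.affineControl {K H₀ : ℝ≥0} (h : ControlledBy μ K H₀) : AffineControl μ :=
  ⟨K, H₀, fun a a' b c => by simpa using h a b c a' b c⟩

theorem AffineControl.controlledBy (h : AffineControl μ) (hs : Symmetry μ) :
    ∃ K H₀ : ℝ≥0, ControlledBy μ K H₀ := by
  obtain ⟨K, H₀, h⟩ := h
  refine ⟨K, 3 * H₀, fun a b c a' b' c' => ?_⟩
  have h₁ := h a a' b c
  have h₂ := h b b' a' c
  have h₃ := h c c' a' b'
  rw [hs.swap_left a' b c, hs.swap_left a' b' c] at h₂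
  rw [← hs.rotate c, ← hs.rotate c'] at h₃
  have h₄ := dist_triangle4 (μ a b c) (μ a' b c) (μ a' b' c) (μ a' b' c')
  push_cast
  linarith

theorem ControlledBy.dist_le {K H₀ : ℝ≥0} (h : ControlledBy μ K H₀) {a b c a' b' c' : X} {δ : ℝ}
    (ha : dist a a' ≤ δ) (hb : dist b b' ≤ δ) (hc : dist c c' ≤ δ) :
    dist (μ a b c) (μ a' b' c') ≤ K * (3 * δ) + H₀ := by
  have : (K : ℝ) * (dist a a' + dist b b' + dist c c') ≤ K * (3 * δ) :=
    mul_le_mul_of_nonneg_left (by linarith) K.2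
  linarith [h a b c a' b' c']

/-- Coarse intervals: the middle point of `[a, b]` is coarsely fixed by projecting to `[a, b]`. -/
theorem dist_interval_le (hl : Localisation μ) (hs : Symmetry μ) {κ : ℝ}
    (hκ : ∀ a b c d, dist (μ (μ a b c) b d) (μ a b (μ c b d)) ≤ κ) {a b e : X}
    (he : e ∈ interval μ a b) : dist (μ a e b) e ≤ κ := by
  obtain ⟨y, rfl⟩ := he
  have := hκ a b a y
  rw [hs.swap_right a a b, hl, hs.swap_right a y b, dist_comm,
    hs.swap_right a (μ a y b) b] at this
  exact this

/-- The error of a term of depth `k` under an `H`-quasi-morphism. -/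
def depthError (K H₀ H : ℝ≥0) (δ : ℝ) : ℕ → ℝ
  | 0 => δ
  | k + 1 => H + (K * (3 * (δ + depthError K H₀ H δ k)) + H₀)

theorem depthError_nonneg (K H₀ H : ℝ≥0) {δ : ℝ} (hδ : 0 ≤ δ) (k : ℕ) :
    0 ≤ depthError K H₀ H δ k := by
  induction k with
  | zero => exact hδ
  | succ k ih => unfold depthError; positivity

namespace Approximation

variable {A : Finset X} {H : ℝ≥0} (P : Approximation μ A H)

theorem dist_emb_med_le {K H₀ : ℝ≥0} (hC : ControlledBy μ K H₀) {x y z : P.carrier} {a b c : X}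
    {δ : ℝ} (hx : dist (P.emb x) a ≤ δ) (hy : dist (P.emb y) b ≤ δ) (hz : dist (P.emb z) c ≤ δ) :
    dist (P.emb (P.med x y z)) (μ a b c) ≤ H + (K * (3 * δ) + H₀) :=
  (dist_triangle _ _ _).trans (add_le_add (P.quasi_morphism x y z) (hC.dist_le hx hy hz))

theorem dist_emb_joinList_le {K H₀ : ℝ≥0} (hC : ControlledBy μ K H₀) (hl : Localisation μ)
    (hs : Symmetry μ) {α β : P.carrier} {a b : X} {δ : ℝ} (hα : dist (P.emb α) a ≤ δ)
    (hβ : dist (P.emb β) b ≤ δ) (l : List P.carrier) (h : ∀ x ∈ l, dist (P.emb x) a ≤ δ) :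
    dist (P.emb (joinList P.med α β l)) a ≤ depthError K H₀ H δ l.length := by
  have hδ : 0 ≤ δ := dist_nonneg.trans hα
  induction l with
  | nil => exact hα
  | cons x l ih =>
    have ih := ih fun y hy => h y (List.mem_cons_of_mem _ hy)
    have hx := h x List.mem_cons_self
    have hd := depthError_nonneg K H₀ H hδ l.length
    have := P.dist_emb_med_le hC (x := x) (y := β) (z := joinList P.med α β l) (a := a) (b := b)
      (c := a) (δ := δ + depthError K H₀ H δ l.length) (by linarith) (by linarith) (by linarith)
    rwa [hs.swap_right, hl] at this

end Approximation

theorem coarseFourPoint_of_approximable {K H₀ : ℝ≥0} (hC : ControlledBy μ K H₀) {H : ℕ → ℝ≥0}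
    (hA : ApproximableBy μ H) : CoarseFourPoint μ := by
  classical
  set δ₁ : ℝ := ((H 4 : ℝ≥0) : ℝ) with hδ₁
  set δ₂ : ℝ := δ₁ + (H 4 + (K * (3 * δ₁) + H₀)) with hδ₂
  set δ₃ : ℝ := H 4 + (K * (3 * δ₂) + H₀) with hδ₃
  have n₁ : 0 ≤ δ₁ := NNReal.coe_nonneg _
  have n₂ : 0 ≤ δ₂ := by positivity
  have n₃ : 0 ≤ δ₃ := by positivity
  -- The summand 1 keeps the constant positive when all errors vanish.
  refine ⟨δ₃ + δ₃ + 1, by positivity, fun a b c d => ?_⟩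
  obtain ⟨P⟩ := hA 4 {a, b, c, d} (Finset.card_pos.2 ⟨a, by simp⟩) Finset.card_le_four
  have pick : ∀ x ∈ ({a, b, c, d} : Finset X), ∃ ξ, dist (P.emb ξ) x ≤ δ₁ :=
    fun x hx => ⟨_, P.close ⟨x, hx⟩⟩
  obtain ⟨α, ha⟩ := pick a (by simp)
  obtain ⟨β, hb⟩ := pick b (by simp)
  obtain ⟨γ, hc⟩ := pick c (by simp)
  obtain ⟨ε, hd⟩ := pick d (by simp)
  have le : ∀ {x y : X}, dist x y ≤ δ₁ → dist x y ≤ δ₂ := fun h =>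
    h.trans (le_add_of_nonneg_right (by positivity))
  have le' : ∀ {x y : X}, dist x y ≤ H 4 + (K * (3 * δ₁) + H₀) → dist x y ≤ δ₂ := fun h =>
    h.trans (le_add_of_nonneg_left n₁)
  have h₁ := P.dist_emb_med_le hC (le' (P.dist_emb_med_le hC ha hb hc)) (le hb) (le hd)
  have h₂ := P.dist_emb_med_le hC (le ha) (le hb) (le' (P.dist_emb_med_le hC hc hb hd))
  rw [P.isMedianAlgebra.four_point, dist_comm] at h₁
  linarith [dist_triangle (μ (μ a b c) b d) (P.emb (P.med α β (P.med γ β ε)))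
    (μ a b (μ c b d))]

theorem noLargeCorners_of_approximable (hl : Localisation μ) (hs : Symmetry μ)
    (h4 : CoarseFourPoint μ) {K H₀ : ℝ≥0} (hC : ControlledBy μ K H₀) {n : ℕ} {H : ℕ → ℝ≥0}
    (hA : ApproximableInRankBy μ n H) : NoLargeCorners μ n := by
  classical
  obtain ⟨κ, hκ0, hκ⟩ := h4
  intro r hr
  set h : ℝ≥0 := H (n + 3) with hh
  -- These bound the errors for the edges moved into the interval (`δ₁`), for their pairwise meets
  -- (`δ₂`) and for the join of those meets (`δ₃`). The list `L` depends on `n` alone, so all are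
  -- fixed before `a`, `b`, `e`.
  set δ₁ : ℝ := h + (h + (K * (3 * h) + H₀) + κ) with hδ₁
  set δ₂ : ℝ := δ₁ + (h + (K * (3 * δ₁) + H₀) + r) with hδ₂
  let L : List (Fin (n + 1) × Fin (n + 1)) := (Finset.univ.filter fun p => p.1 ≠ p.2).toList
  set δ₃ : ℝ := δ₂ + depthError K H₀ h δ₂ L.length with hδ₃
  have n₁ : 0 ≤ δ₁ := by positivity
  have n₂ : 0 ≤ δ₂ := by positivity
  have nd := depthError_nonneg K H₀ h n₂ L.length
  refine ⟨δ₂ + (h + (K * (3 * δ₃) + H₀)), fun a b e he hd => ?_⟩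
  obtain ⟨P, hP⟩ := hA (n + 3) (insert a (insert b (Finset.univ.image e)))
    (Finset.card_pos.2 ⟨a, by simp⟩) (by
      have := Finset.card_image_le (s := Finset.univ) (f := e)
      have h₁ := Finset.card_insert_le b (Finset.univ.image e)
      have h₂ := Finset.card_insert_le a (insert b (Finset.univ.image e))
      simp at this
      omega)
  have pick : ∀ x ∈ insert a (insert b (Finset.univ.image e)), ∃ ξ, dist (P.emb ξ) x ≤ h :=
    fun x hx => ⟨_, P.close ⟨x, hx⟩⟩
  obtain ⟨α, hα⟩ := pick a (by simp)
  obtain ⟨β, hβ⟩ := pick b (by simp)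
  have : ∀ i, ∃ ξ, dist (P.emb ξ) (e i) ≤ h := fun i => pick (e i) (by simp)
  choose ξ hξ using this
  have le₁ : ∀ {x y : X}, dist x y ≤ h → dist x y ≤ δ₁ := fun h =>
    h.trans (le_add_of_nonneg_right (by positivity))
  have le₂ : ∀ {x y : X}, dist x y ≤ δ₁ → dist x y ≤ δ₂ := fun h =>
    h.trans (le_add_of_nonneg_right (by positivity))
  have le₃ : ∀ {x y : X}, dist x y ≤ δ₂ → dist x y ≤ δ₃ := fun h =>
    h.trans (le_add_of_nonneg_right nd)
  have hm := P.isMedianAlgebra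
  -- The points `ξ i` need not lie between `α` and `β`; projecting them costs a bounded error
  -- because `e i` is coarsely fixed by the projection to `[a, b]`.
  let η : Fin (n + 1) → P.carrier := fun i => P.med α (ξ i) β
  have hη : ∀ i, P.med α (η i) β = η i := fun i => by
    rw [hm.symmetry.swap_left]; exact hm.btw_med₁₃ _ _ _
  have hηe : ∀ i, dist (P.emb (η i)) (e i) ≤ δ₁ := fun i => by
    have h₁ := P.dist_emb_med_le hC hα (hξ i) hβ
    have h₂ := dist_interval_le hl hs hκ (he i)
    have h₃ := dist_triangle (P.emb (η i)) (μ a (e i) b) (e i)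
    have : (0 : ℝ) ≤ h := h.2
    linarith
  have hinf : ∀ i j, i ≠ j → dist (P.emb (P.med (η i) α (η j))) a ≤ δ₂ := fun i j hij => by
    have h₁ := P.dist_emb_med_le hC (hηe i) (le₁ hα) (hηe j)
    have h₂ := hd i j hij
    have h₃ := dist_triangle (P.emb (P.med (η i) α (η j))) (μ (e i) a (e j)) a
    linarith
  let l : List P.carrier := L.map fun p => P.med (η p.1) α (η p.2)
  have hmem : ∀ x, x ∈ l ↔ ∃ i j, i ≠ j ∧ x = P.med (η i) α (η j) := by
    intro x
    simp only [l, L, List.mem_map, Finset.mem_toList, Finset.mem_filter, Finset.mem_univ, true_and,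
      Prod.exists, eq_comm (a := x)]
  obtain ⟨hcorner, hcol⟩ := hm.exists_isCorner_join hη hmem
  obtain ⟨i, hi⟩ := hm.medianRank_le_iff.1 hP _ _ _ hcorner
  have hc : dist (P.emb (joinList P.med α β l)) a ≤ δ₃ := by
    have := P.dist_emb_joinList_le hC hl hs (le₂ (le₁ hα)) (le₂ (le₁ hβ)) l (by
      intro x hx
      obtain ⟨i, j, hij, rfl⟩ := (hmem x).1 hx
      exact hinf i j hij)
    rw [show l.length = L.length by simp [l]] at this
    linarith
  refine ⟨i, ?_⟩
  -- The degenerate edge gives `η i` as its own meet with the join, whose image is near `μ (e i) a a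
  -- = a`.
  have h₁ := P.dist_emb_med_le hC (le₃ (le₂ (hηe i))) (le₃ (le₂ (le₁ hα))) hc
  rw [← hcol i hi, hs.rotate a (e i) a, hs.swap_right, hl] at h₁
  have h₂ := hηe i
  rw [dist_comm] at h₂
  linarith [dist_triangle (e i) (P.emb (η i)) a, le₂ (hηe i), dist_comm (e i) (P.emb (η i))]

end Coarse
-- From the coarse axioms to approximations, by an ultrafilter limit
section BoundedLimit

open Filter

/-- Two sequences are equivalent if they are at bounded distance along a nonprincipal
ultrafilter. -/
def boundedSetoid (X : Type*) [MetricSpace X] : Setoid (ℕ → X) where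
  r f g := ∃ D : ℝ, ∀ᶠ k in (hyperfilter ℕ : Filter ℕ), dist (f k) (g k) ≤ D
  iseqv := {
    refl := fun f => ⟨0, by simp⟩
    symm := by
      rintro f g ⟨D, h⟩
      exact ⟨D, by simpa only [dist_comm] using h⟩
    trans := by
      rintro f g h ⟨D, h₁⟩ ⟨E, h₂⟩
      refine ⟨D + E, ?_⟩
      filter_upwards [h₁, h₂] with k h₁ h₂
      exact (dist_triangle _ _ _).trans (add_le_add h₁ h₂) }

/-- Sequences in `X` up to bounded distance along a nonprincipal ultrafilter. -/
abbrev BoundedLimit (X : Type*) [MetricSpace X] : Type _ := Quotient (boundedSetoid X)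

variable {X : Type*} [MetricSpace X] {μ : X → X → X → X}

/-- The class of a sequence. -/
abbrev BoundedLimit.mk (f : ℕ → X) : BoundedLimit X := Quotient.mk (boundedSetoid X) f

theorem BoundedLimit.mk_eq {f g : ℕ → X} : BoundedLimit.mk f = BoundedLimit.mk g ↔
    ∃ D : ℝ, ∀ᶠ k in (hyperfilter ℕ : Filter ℕ), dist (f k) (g k) ≤ D :=
  Quotient.eq

theorem BoundedLimit.mk_eq_of_le {f g : ℕ → X} (D : ℝ) (h : ∀ k, dist (f k) (g k) ≤ D) :
    BoundedLimit.mk f = BoundedLimit.mk g :=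
  BoundedLimit.mk_eq.2 ⟨D, Eventually.of_forall h⟩

/-- The ternary operation on classes of sequences induced by `μ`. -/
noncomputable def limitMedian (μ : X → X → X → X) (x y z : BoundedLimit X) : BoundedLimit X :=
  BoundedLimit.mk fun k => μ (x.out k) (y.out k) (z.out k)

/-- Affine control keeps bounded changes of the arguments bounded, so any representatives may be
used. -/
theorem limitMedian_mk {K H₀ : ℝ≥0} (hC : ControlledBy μ K H₀) (f g h : ℕ → X) :
    limitMedian μ (.mk f) (.mk g) (.mk h) = .mk fun k => μ (f k) (g k) (h k) := by
  have out : ∀ f : ℕ → X, ∃ D : ℝ, ∀ᶠ k in (hyperfilter ℕ : Filter ℕ),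
      dist ((BoundedLimit.mk f).out k) (f k) ≤ D :=
    fun f => BoundedLimit.mk_eq.1 (Quotient.out_eq (BoundedLimit.mk f))
  obtain ⟨D₁, h₁⟩ := out f
  obtain ⟨D₂, h₂⟩ := out g
  obtain ⟨D₃, h₃⟩ := out h
  refine BoundedLimit.mk_eq.2 ⟨K * (3 * max D₁ (max D₂ D₃)) + H₀, ?_⟩
  filter_upwards [h₁, h₂, h₃] with k h₁ h₂ h₃
  exact hC.dist_le (h₁.trans (le_max_left _ _))
    (h₂.trans ((le_max_left _ _).trans (le_max_right _ _)))
    (h₃.trans ((le_max_right _ _).trans (le_max_right _ _)))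

theorem isMedianAlgebra_limitMedian (hl : Localisation μ) (hs : Symmetry μ) {K H₀ : ℝ≥0}
    (hC : ControlledBy μ K H₀) (h4 : CoarseFourPoint μ) :
    IsMedianAlgebra (limitMedian μ) where
  localisation a b := by
    induction a using Quotient.inductionOn with | _ f
    induction b using Quotient.inductionOn with | _ g
    refine (limitMedian_mk hC f f g).trans ?_
    simp only [hl (f _) (g _)]
  symmetry := by
    refine symmetry_of_swap (fun a b c => ?_) fun a b c => ?_
    · unfold limitMedian
      simp only [hs.swap_left (a.out _) (b.out _)]
    · unfold limitMedian
      simp only [hs.swap_right (a.out _) (b.out _) (c.out _)]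
  four_point a b c d := by
    obtain ⟨κ, -, hκ⟩ := h4
    induction a using Quotient.inductionOn with | _ f
    induction b using Quotient.inductionOn with | _ g
    induction c using Quotient.inductionOn with | _ h
    induction d using Quotient.inductionOn with | _ i
    rw [limitMedian_mk hC f g h, limitMedian_mk hC h g i, limitMedian_mk hC,
      limitMedian_mk hC f g]
    exact BoundedLimit.mk_eq_of_le κ fun k => hκ _ _ _ _

/-- Without large corners in `X`, corners with `n + 1` edges in the limit are degenerate. -/
theorem NoLargeCorners.limit {n : ℕ} (h3 : NoLargeCorners μ n) {K H₀ : ℝ≥0}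
    (hC : ControlledBy μ K H₀) {a b : BoundedLimit X} {e : Fin (n + 1) → BoundedLimit X}
    (he : IsCorner (limitMedian μ) a b e) : ∃ i, e i = a := by
  induction a using Quotient.inductionOn with | _ a
  induction b using Quotient.inductionOn with | _ b
  -- These representatives lie in the interval at every index, not just up to bounded distance.
  let f : Fin (n + 1) → ℕ → X := fun i k => μ (a k) ((e i).out k) (b k)
  have hf : ∀ i, BoundedLimit.mk (f i) = e i := fun i => by
    rw [← he.btw i]
    conv_rhs => rw [← Quotient.out_eq (e i)]
    exact (limitMedian_mk hC _ _ _).symm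
  have hd : ∀ p : {p : Fin (n + 1) × Fin (n + 1) // p.1 ≠ p.2}, ∃ D : ℝ,
      ∀ᶠ k in (hyperfilter ℕ : Filter ℕ), dist (μ (f p.1.1 k) (a k) (f p.1.2 k)) (a k) ≤ D :=
    fun p => by
      have := he.disjoint _ _ p.2
      rw [← hf, ← hf] at this
      exact BoundedLimit.mk_eq.1 ((limitMedian_mk hC _ _ _).symm.trans this)
  choose D hD using hd
  obtain ⟨R, hR⟩ := (Set.finite_range D).bddAbove
  obtain ⟨C, hCC⟩ := h3 (max R 1) (by positivity)
  have hev : ∀ᶠ k in (hyperfilter ℕ : Filter ℕ), ∃ i, dist (f i k) (a k) ≤ C := by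
    filter_upwards [eventually_all.2 hD] with k hk
    refine hCC (a k) (b k) (fun i => f i k) (fun i => ⟨_, rfl⟩) fun i j hij => ?_
    exact (hk ⟨(i, j), hij⟩).trans ((hR ⟨_, rfl⟩).trans (le_max_left _ _))
  -- The short edge may vary with `k`; an ultrafilter selects one of finitely many.
  obtain ⟨i, hi⟩ := Ultrafilter.eventually_exists_iff.1 hev
  exact ⟨i, (hf i).symm.trans (BoundedLimit.mk_eq.2 ⟨C, hi⟩)⟩

/-- Sets of at most `p` points are uniformly approximated by finite median algebras of rank at
most `n`. -/
theorem exists_uniform_approximation (hl : Localisation μ) (hs : Symmetry μ) {K H₀ : ℝ≥0}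
    (hC : ControlledBy μ K H₀) (h4 : CoarseFourPoint μ) {n : ℕ} (h3 : NoLargeCorners μ n)
    (p : ℕ) : ∃ H : ℝ≥0, ∀ A : Finset X, 1 ≤ A.card → A.card ≤ p →
      ∃ P : Approximation μ A H, medianRank P.med ≤ n := by
  by_contra! hcon
  choose A hA₁ hAp hbad using fun k : ℕ => hcon k
  -- Enumerating with repetitions gives every `A k` the same index set, so the points form `p`
  -- sequences.
  have hsurj : ∀ k, ∃ g : Fin p → X, ∀ x ∈ A k, ∃ j, g j = x := by
    intro k
    have : Nonempty (A k) := (Finset.card_pos.1 (hA₁ k)).to_subtype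
    obtain ⟨g, hg⟩ : ∃ g : Fin p → A k, Function.Surjective g := by
      have hle : Fintype.card (A k) ≤ Fintype.card (Fin p) := by simpa using hAp k
      obtain ⟨φ⟩ := Function.Embedding.nonempty_of_card_le hle
      exact ⟨Function.invFun φ, Function.invFun_surjective φ.injective⟩
    exact ⟨fun j => g j, fun x hx => (hg ⟨x, hx⟩).imp fun j hj => congrArg Subtype.val hj⟩
  choose g hg using hsurj
  have hM := isMedianAlgebra_limitMedian hl hs hC h4
  obtain ⟨N, f, med, hf, hmed, hgen⟩ :=
    hM.exists_finite_subalgebra fun j : Fin p => BoundedLimit.mk fun k => g k j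
  choose s hs' using hgen
  have hmedalg := isMedianAlgebra_of_injective hM hf hmed
  have hrank : medianRank med ≤ n := by
    refine hmedalg.medianRank_le_iff.2 fun a b e he => ?_
    have : IsCorner (limitMedian μ) (f a) (f b) (fun i => f (e i)) :=
      ⟨fun i => by rw [← hmed, he.btw], fun i j hij => by rw [← hmed, he.disjoint i j hij]⟩
    obtain ⟨i, hi⟩ := h3.limit hC this
    exact ⟨i, hf hi⟩
  have hq : ∀ t : Fin N × Fin N × Fin N, ∃ D : ℝ, ∀ᶠ k in (hyperfilter ℕ : Filter ℕ),
      dist ((f (med t.1 t.2.1 t.2.2)).out k)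
        (μ ((f t.1).out k) ((f t.2.1).out k) ((f t.2.2).out k)) ≤ D := by
    intro t
    refine BoundedLimit.mk_eq.1 ((Quotient.out_eq _).trans ?_)
    rw [hmed]
    rfl
  have hc : ∀ j, ∃ D : ℝ, ∀ᶠ k in (hyperfilter ℕ : Filter ℕ),
      dist ((f (s j)).out k) (g k j) ≤ D := fun j =>
    BoundedLimit.mk_eq.1 ((Quotient.out_eq _).trans (hs' j))
  choose D hD using hq
  choose E hE using hc
  obtain ⟨D', hD'⟩ := (Set.finite_range D).bddAbove
  obtain ⟨E', hE'⟩ := (Set.finite_range E).bddAbove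
  -- The error refuted at index `k` is `k` itself, so a late index exceeds the finitely many bounds.
  have hlarge : ∀ᶠ k : ℕ in (hyperfilter ℕ : Filter ℕ), max D' E' ≤ k :=
    Nat.hyperfilter_le_atTop (tendsto_natCast_atTop_atTop.eventually_ge_atTop _)
  obtain ⟨k, hkD, hkE, hk⟩ :=
    ((eventually_all.2 hD).and ((eventually_all.2 hE).and hlarge)).exists
  choose j hj using hg k
  refine (hbad k {
    carrier := Fin N
    finite := inferInstance
    med := med
    isMedianAlgebra := hmedalg
    proj := fun a => s (j a a.2)
    emb := fun x => (f x).out k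
    quasi_morphism := fun x y z => ?_
    close := fun a => ?_ }).not_ge hrank
  · exact (hkD (x, y, z)).trans ((hD' ⟨_, rfl⟩).trans ((le_max_left _ _).trans (by simpa using hk)))
  · have := hkE (j a a.2)
    rw [hj a a.2] at this
    exact this.trans ((hE' ⟨_, rfl⟩).trans ((le_max_right _ _).trans (by simpa using hk)))

end BoundedLimit

end CoarseMedian

theorem theorem4p12 {X : Type*} [MetricSpace X] (μ : X → X → X → X) (n : ℕ) :
    (CoarseMedian.IsCoarseMedianSpace μ ∧ CoarseMedian.HasRankAtMost μ n) ↔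
      (CoarseMedian.Localisation μ ∧
        CoarseMedian.Symmetry μ ∧
        CoarseMedian.AffineControl μ ∧
        CoarseMedian.CoarseFourPoint μ ∧
        CoarseMedian.NoLargeCorners μ n) := by
  constructor
  · rintro ⟨⟨hl, hs, -, -⟩, K, H₀, H, hC, hA⟩
    have h4 := CoarseMedian.coarseFourPoint_of_approximable hC
      fun p A h₁ h₂ => ⟨(hA p A h₁ h₂).choose⟩
    exact ⟨hl, hs, hC.affineControl, h4,
      CoarseMedian.noLargeCorners_of_approximable hl hs h4 hC hA⟩
  · rintro ⟨hl, hs, h1, h4, h3⟩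
    obtain ⟨K, H₀, hC⟩ := h1.controlledBy hs
    choose H hH using CoarseMedian.exists_uniform_approximation hl hs hC h4 h3
    exact ⟨⟨hl, hs, ⟨K, H₀, hC⟩, H, fun p A h₁ h₂ => ⟨(hH p A h₁ h₂).choose⟩⟩,
      K, H₀, H, hC, hH⟩
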